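/- Let $M$ be a Markov decision process with finite nonempty state space $S$ and finite nonempty action space $A$, transition probabilities $P(s'\mid s,a)$ and rewards $r(s,a)\in\mathbb{R}$. For a memoryless (possibly randomized) policy $\pi$, with $\pi(a\mid s)$ the probability of action $a$ in state $s$, put $$P^\pi(s,s')=\sum_a \pi(a\mid s)P(s'\mid s,a),\qquad r^\pi(s)=\sum_a\pi(a\mid s)r(s,a).$$ Let $S_t$ and $R_t$ be the state and reward at time $t=1,2,\dots$, and let $\mathbf{E}^\pi_s$ denote expectation under $\pi$ with $S_1=s$. The gain of $\pi$ is $g^\pi(s)=\lim_{T\to\infty}\frac1T\,\mathbf{E}^\pi_s\sum_{t=1}^T R_t$, and the bias of $\pi$ is $$h^\pi(s)=\lim_{N\to\infty}\frac1N\sum_{T=1}^N \mathbf{E}^\pi_s\sum_{t=1}^T\bigl(R_t-g^\pi(S_t)\bigr)$$ (the Cesàro limit, which equals $\lim_{T\to\infty}\mathbf{E}^\pi_s\sum_{t=1}^T(R_t-g^\pi(S_t))$ whenever the latter exists). For $h\in\mathbb{R}^S$ let $\mathsf{sp}(h)=\max_s h(s)-\min_s h(s)$. Let $P^\pi_\infty=\lim_{N\to\infty}\frac1N\sum_{n=0}^{N-1}(P^\pi)^n$,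 and let $$\kappa^\pi=\operatorname{tr}\bigl((I-P^\pi+P^\pi_\infty)^{-1}(I-P^\pi_\infty)\bigr)$$ be the Kemeny constant of $P^\pi$ (the trace of the deviation matrix, i.e. of the group inverse of $I-P^\pi$). The process $M$ is *ergodic* if under every deterministic memoryless policy all states form a single recurrent class; *unichain* if every deterministic memoryless policy induces a chain with exactly one recurrent class (and possibly some transient states); *weakly communicating* if there is a nonempty set of states that is closed under all actions, in which each state is accessible from every other under some deterministic memoryless policy, and all states outside it are transient under every memoryless policy. A memoryless policy $\pi^*$ is *optimal* if $g^{\pi^*}(s)\ge g^{\pi}(s)$ for all states $s$ and all memoryless policies $\pi$. 1. If $M$ is ergodic or unichain, then for every memoryless policy $\pi$ the limits defining $g^\pi$, $h^\pi$ and $P^\pi_\infty$ exist, $I-P^\pi+P^\pi_\infty$ is invertible, and $$\mathsf{sp}(h^\pi)\le 2\,\mathsf{sp}(r^\pi)\,\kappa^\pi .$$ 2. If $M$ is weakly communicating, then the same conclusions hold for every optimal policy $\pi^*$; in particular, with $h^*=h^{\pi^*}$, $r^*=r^{\pi^*}$ and $\kappa^*=\kappa^{\pi^*}$, $$\mathsf{sp}(h^*)\le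 2\,\mathsf{sp}(r^*)\,\kappa^* .$$ -/

import Mathlib

open Filter Topology

noncomputable section

/-! ### Finite Markov chains, given by a transition matrix -/

namespace FinChain

variable {S : Type*} [Fintype S] [DecidableEq S]

/-- The state `y` is accessible from `x`: it is reached with positive probability in some number
of steps (possibly zero). -/
def Accessible (P : Matrix S S ℝ) (x y : S) : Prop :=
  ∃ n : ℕ, 0 < (P ^ n) x y

/-- The state `x` is transient: the expected number of visits to `x` from `x` is finite. -/
def IsTransient (P : Matrix S S ℝ) (x : S) : Prop :=
  Summable fun n : ℕ => (P ^ n) x x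

/-- A state is recurrent if it is not transient. -/
def IsRecurrent (P : Matrix S S ℝ) (x : S) : Prop :=
  ¬ IsTransient P x

/-- `C` is a recurrent class: the communicating class of a recurrent state. -/
def IsRecurrentClass (P : Matrix S S ℝ) (C : Set S) : Prop :=
  ∃ x, IsRecurrent P x ∧ C = {y | Accessible P x y ∧ Accessible P y x}

/-- The averages `(1 / N) ∑_{n < N} P ^ n`. -/
def cesaroMean (P : Matrix S S ℝ) (N : ℕ) : Matrix S S ℝ :=
  (N : ℝ)⁻¹ • ∑ n ∈ Finset.range N, P ^ n

/-- The limiting matrix `P_∞ = lim_N (1 / N) ∑_{n < N} P ^ n`. -/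
def limitMatrix (P : Matrix S S ℝ) : Matrix S S ℝ :=
  limUnder atTop (cesaroMean P)

/-- The deviation matrix `H = (I - P)^# = (I - P + P_∞)⁻¹ (I - P_∞)`. -/
def deviationMatrix (P : Matrix S S ℝ) : Matrix S S ℝ :=
  (1 - P + limitMatrix P)⁻¹ * (1 - limitMatrix P)

/-- The Kemeny constant, the trace of the deviation matrix. -/
def kemeny (P : Matrix S S ℝ) : ℝ :=
  (deviationMatrix P).trace

/-- The limit and the inverse in the definition of the Kemeny constant exist. -/
def KemenyDefined (P : Matrix S S ℝ) : Prop :=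
  Tendsto (cesaroMean P) atTop (𝓝 (limitMatrix P)) ∧ IsUnit (1 - P + limitMatrix P)

end FinChain

/-- The span of a vector: its largest entry minus its smallest entry. -/
def vecSpan {S : Type*} [Fintype S] (h : S → ℝ) : ℝ :=
  (⨆ s, h s) - ⨅ s, h s

/-! ### Markov decision processes -/

/-- A finite Markov decision process: transition probabilities `P(s' | s, a) = trans s a s'` and
rewards `r(s, a) = reward s a`. (Horizon and initial distribution play no role for the
gain, the bias and the classification of the process, and are not recorded.) -/
structure FiniteMDP (S A : Type*) [Fintype S] where
  trans : S → A → S → ℝ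
  reward : S → A → ℝ
  trans_nonneg : ∀ s a s', 0 ≤ trans s a s'
  trans_sum : ∀ s a, ∑ s', trans s a s' = 1

/-- A memoryless, possibly randomized policy: action `a` is played in state `s` with probability
`prob s a`. -/
structure MemorylessPolicy (S A : Type*) [Fintype A] where
  prob : S → A → ℝ
  prob_nonneg : ∀ s a, 0 ≤ prob s a
  prob_sum : ∀ s, ∑ a, prob s a = 1

/-- A deterministic policy plays one action with probability one in each state. -/
def MemorylessPolicy.IsDeterministic {S A : Type*} [Fintype A] (π : MemorylessPolicy S A) : Prop :=
  ∀ s, ∃ a, π.prob s a = 1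

namespace FiniteMDP

variable {S A : Type*} [Fintype S] [DecidableEq S] [Fintype A]

/-- The transition matrix `P^π` of the chain induced by `π`. -/
def chain (M : FiniteMDP S A) (π : MemorylessPolicy S A) : Matrix S S ℝ :=
  Matrix.of fun s s' => ∑ a, π.prob s a * M.trans s a s'

/-- The reward vector `r^π` induced by `π`. -/
def rewardVec (M : FiniteMDP S A) (π : MemorylessPolicy S A) (s : S) : ℝ :=
  ∑ a, π.prob s a * M.reward s a

/-- `M.stateLaw π s t x` is the probability that the state after `t` transitions is `x`, when the
process starts in `s` and `π` is played. (The time step `t = 1, 2, …` of an infinite run is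
indexed by `t = 0, 1, …` here and below.) -/
def stateLaw (M : FiniteMDP S A) (π : MemorylessPolicy S A) (s : S) : ℕ → S → ℝ
  | 0 => Pi.single s 1
  | t + 1 => fun y => ∑ x, M.stateLaw π s t x * ∑ a, π.prob x a * M.trans x a y

/-- The expectation of `f (S_t)` under `π` for the initial state `s`. -/
def expect (M : FiniteMDP S A) (π : MemorylessPolicy S A) (s : S) (t : ℕ) (f : S → ℝ) : ℝ :=
  ∑ x, M.stateLaw π s t x * f x

/-- The expected average reward collected in the first `T` steps. The conditional
expectation of the reward `R_t` given `S_t` is `r^π (S_t)`. -/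
def avgReward (M : FiniteMDP S A) (π : MemorylessPolicy S A) (s : S) (T : ℕ) : ℝ :=
  (T : ℝ)⁻¹ * ∑ t ∈ Finset.range T, M.expect π s t (M.rewardVec π)

/-- The gain `g^π`. -/
def gain (M : FiniteMDP S A) (π : MemorylessPolicy S A) (s : S) : ℝ :=
  limUnder atTop (M.avgReward π s)

/-- The expected value of `∑ (R_t - g^π (S_t))` over the first `T` steps. -/
def excess (M : FiniteMDP S A) (π : MemorylessPolicy S A) (s : S) (T : ℕ) : ℝ :=
  ∑ t ∈ Finset.range T, M.expect π s t (fun x => M.rewardVec π x - M.gain π x)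

/-- The averages of `M.excess π s T` over `T = 1, …, N`. -/
def avgExcess (M : FiniteMDP S A) (π : MemorylessPolicy S A) (s : S) (N : ℕ) : ℝ :=
  (N : ℝ)⁻¹ * ∑ T ∈ Finset.Icc 1 N, M.excess π s T

/-- The bias `h^π`: the limit of `M.excess π s T` as `T → ∞`, in the sense of Cesàro, as is
needed for periodic chains. Wherever the ordinary limit exists, it has this value. -/
def bias (M : FiniteMDP S A) (π : MemorylessPolicy S A) (s : S) : ℝ :=
  limUnder atTop (M.avgExcess π s)

/-- The limits that define gain and bias exist. -/
def GainBiasDefined (M : FiniteMDP S A) (π : MemorylessPolicy S A) : Prop :=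
  (∀ s, Tendsto (M.avgReward π s) atTop (𝓝 (M.gain π s))) ∧
    ∀ s, Tendsto (M.avgExcess π s) atTop (𝓝 (M.bias π s))

/-- An optimal policy: it maximizes the gain from every initial state. -/
def IsOptimal (M : FiniteMDP S A) (π : MemorylessPolicy S A) : Prop :=
  ∀ (π' : MemorylessPolicy S A) (s : S), M.gain π' s ≤ M.gain π s

/-- Recurrent (ergodic): under every deterministic policy, all states form a single
recurrent class. -/
def IsErgodic (M : FiniteMDP S A) : Prop :=
  ∀ π : MemorylessPolicy S A, π.IsDeterministic →
    FinChain.IsRecurrentClass (M.chain π) Set.univ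

/-- Unichain: under every deterministic policy, there is exactly one recurrent class (and
possibly some transient states). -/
def IsUnichain (M : FiniteMDP S A) : Prop :=
  ∀ π : MemorylessPolicy S A, π.IsDeterministic →
    ∃! C : Set S, FinChain.IsRecurrentClass (M.chain π) C

/-- Weakly communicating: there is a closed set of states, each accessible from each other under
some deterministic policy, and all other states are transient under every policy. -/
def IsWeaklyCommunicating (M : FiniteMDP S A) : Prop :=
  ∃ C : Set S, C.Nonempty ∧
    (∀ s ∈ C, ∀ a s', 0 < M.trans s a s' → s' ∈ C) ∧
    (∀ s ∈ C, ∀ s' ∈ C, ∃ π : MemorylessPolicy S A, π.IsDeterministic ∧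
      FinChain.Accessible (M.chain π) s s') ∧
    ∀ s ∉ C, ∀ π : MemorylessPolicy S A, FinChain.IsTransient (M.chain π) s

end FiniteMDP

end

/-! For a stochastic matrix `P` the bias is `H r`, where `H` is the deviation matrix. Power
boundedness makes the kernel and range of `1 - P` complementary, so the Cesàro means converge to the
projection `Q` onto the kernel along the range, `1 - P + Q` is invertible, and telescoping the
excess identifies the bias (`tendsto_avg_geom_sum`). Two facts bound the span: the rows of `H` sum
to zero, and each column of `H` is largest on the diagonal (`deviationMatrix_le_diag`). A difference
of two entries of `H r` is then at most the span of `r` times the trace of `H`. This is sharper by a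
factor 2 than required, and the trace is nonnegative. -/

set_option linter.unusedSectionVars false

namespace FinChain

variable {S : Type*} [Fintype S] [DecidableEq S]

open Matrix

/-- A real matrix is stochastic if its entries are nonnegative and its rows sum to one. -/
structure IsStochastic (P : Matrix S S ℝ) : Prop where
  nonneg : ∀ x y, 0 ≤ P x y
  mulVec_one : P *ᵥ 1 = 1

namespace IsStochastic

variable {P : Matrix S S ℝ}

theorem row_sum (hP : IsStochastic P) (x : S) : ∑ y, P x y = 1 := by
  simpa [mulVec, dotProduct] using congrFun hP.mulVec_one x

theorem pow (hP : IsStochastic P) (n : ℕ) : IsStochastic (P ^ n) := by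
  induction n with
  | zero =>
    refine ⟨fun x y => ?_, by simp⟩
    rw [pow_zero, one_apply]
    split_ifs <;> norm_num
  | succ n ih =>
    refine ⟨fun x y => ?_, ?_⟩
    · rw [pow_succ, mul_apply]
      exact Finset.sum_nonneg fun z _ => mul_nonneg (ih.nonneg x z) (hP.nonneg z y)
    · rw [pow_succ, ← mulVec_mulVec, hP.mulVec_one, ih.mulVec_one]

theorem abs_mulVec_le (hP : IsStochastic P) {v : S → ℝ} {B : ℝ} (hv : ∀ y, |v y| ≤ B) (x : S) :
    |(P *ᵥ v) x| ≤ B :=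
  calc |∑ y, P x y * v y| ≤ ∑ y, |P x y * v y| := Finset.abs_sum_le_sum_abs _ _
    _ ≤ ∑ y, P x y * B := by
        refine Finset.sum_le_sum fun y _ => ?_
        rw [abs_mul, abs_of_nonneg (hP.nonneg x y)]
        exact mul_le_mul_of_nonneg_left (hv y) (hP.nonneg x y)
    _ = B := by rw [← Finset.sum_mul, hP.row_sum, one_mul]

theorem exists_bound_pow_mulVec (hP : IsStochastic P) (v : S → ℝ) :
    ∃ B, ∀ n x, |(P ^ n *ᵥ v) x| ≤ B :=
  ⟨∑ y, |v y|, fun n => (hP.pow n).abs_mulVec_le fun y =>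
    Finset.single_le_sum (f := fun y => |v y|) (fun _ _ => abs_nonneg _) (Finset.mem_univ y)⟩

end IsStochastic

/-! ### Cesàro means and the mean ergodic theorem -/

theorem pow_mulVec_of_fixed {P : Matrix S S ℝ} {v : S → ℝ} (hv : P *ᵥ v = v) (n : ℕ) :
    P ^ n *ᵥ v = v := by
  induction n with
  | zero => simp
  | succ n ih => rw [pow_succ, ← mulVec_mulVec, hv, ih]

theorem tendsto_natCast_inv_mul {u : ℕ → ℝ} {B : ℝ} (hu : ∀ n, |u n| ≤ B) :
    Tendsto (fun n : ℕ => (n : ℝ)⁻¹ * u n) atTop (𝓝 0) := by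
  have h : Tendsto (fun n : ℕ => (n : ℝ)⁻¹ * B) atTop (𝓝 0) := by
    simpa using (tendsto_inv_atTop_nhds_zero_nat (𝕜 := ℝ)).mul_const B
  refine squeeze_zero_norm (fun n => ?_) h
  rw [Real.norm_eq_abs, abs_mul, abs_of_nonneg (by positivity : (0 : ℝ) ≤ (n : ℝ)⁻¹)]
  exact mul_le_mul_of_nonneg_left (hu n) (by positivity)

theorem cesaroMean_mulVec_of_fixed {P : Matrix S S ℝ} {v : S → ℝ} (hv : P *ᵥ v = v) {N : ℕ}
    (hN : N ≠ 0) : cesaroMean P N *ᵥ v = v := by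
  rw [cesaroMean, smul_mulVec, sum_mulVec, Finset.sum_congr rfl fun n _ => pow_mulVec_of_fixed hv n]
  ext x
  simp [hN]

theorem geom_sum_mulVec (P : Matrix S S ℝ) (u : S → ℝ) (N : ℕ) :
    (∑ n ∈ Finset.range N, P ^ n) *ᵥ ((1 - P) *ᵥ u) = u - P ^ N *ᵥ u := by
  rw [mulVec_mulVec, geom_sum_mul_neg, sub_mulVec, one_mulVec]

namespace IsStochastic

variable {P : Matrix S S ℝ}

/-- The sum of powers telescopes to `u - P ^ N *ᵥ u`, which stays bounded, and the factor `1 / N`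
sends it to zero. -/
theorem tendsto_cesaroMean_mulVec_range (hP : IsStochastic P) (u : S → ℝ) :
    Tendsto (fun N => cesaroMean P N *ᵥ ((1 - P) *ᵥ u)) atTop (𝓝 0) := by
  obtain ⟨B, hB⟩ := hP.exists_bound_pow_mulVec u
  refine tendsto_pi_nhds.2 fun x => ?_
  have h : ∀ N, (cesaroMean P N *ᵥ ((1 - P) *ᵥ u)) x
      = (N : ℝ)⁻¹ * (u x - (P ^ N *ᵥ u) x) := fun N => by
    rw [cesaroMean, smul_mulVec, geom_sum_mulVec]
    rfl
  simp only [h]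
  refine tendsto_natCast_inv_mul (B := B + B) fun N => (abs_sub _ _).trans (add_le_add ?_ (hB N x))
  simpa using hB 0 x

/-- Power boundedness separates the fixed vectors of `P` from the range of `1 - P`. -/
theorem eq_zero_of_fixed_of_range (hP : IsStochastic P) {u : S → ℝ}
    (h : P *ᵥ ((1 - P) *ᵥ u) = (1 - P) *ᵥ u) : (1 - P) *ᵥ u = 0 := by
  -- The Cesàro means of this vector are eventually constant, yet tend to zero.
  refine tendsto_nhds_unique (tendsto_const_nhds.congr' ?_) (hP.tendsto_cesaroMean_mulVec_range u)
  filter_upwards [eventually_ne_atTop 0] with N hN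
  exact (cesaroMean_mulVec_of_fixed h hN).symm

theorem exists_fixed_add_range (hP : IsStochastic P) (v : S → ℝ) :
    ∃ k u : S → ℝ, P *ᵥ k = k ∧ v = k + (1 - P) *ᵥ u := by
  set f : (S → ℝ) →ₗ[ℝ] (S → ℝ) := (1 - P).mulVecLin
  have hker : ∀ {k}, k ∈ LinearMap.ker f ↔ P *ᵥ k = k := fun {k} => by
    rw [LinearMap.mem_ker, mulVecLin_apply, sub_mulVec, one_mulVec, sub_eq_zero, eq_comm]
  have hdisj : Disjoint (LinearMap.ker f) (LinearMap.range f) := by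
    rw [Submodule.disjoint_def]
    rintro _ hk ⟨u, rfl⟩
    exact hP.eq_zero_of_fixed_of_range (hker.1 hk)
  have htop : LinearMap.ker f ⊔ LinearMap.range f = ⊤ := by
    -- By rank-nullity the dimensions add up to that of the whole space, so disjointness suffices.
    refine Submodule.eq_top_of_disjoint _ _ ?_ hdisj
    rw [add_comm, LinearMap.finrank_range_add_finrank_ker]
  obtain ⟨k, hk, _, ⟨u, rfl⟩, h⟩ :=
    Submodule.mem_sup.1 (htop ▸ Submodule.mem_top : v ∈ LinearMap.ker f ⊔ LinearMap.range f)
  exact ⟨k, u, hker.1 hk, h.symm⟩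

theorem exists_tendsto_cesaroMean_mulVec (hP : IsStochastic P) (v : S → ℝ) :
    ∃ k, P *ᵥ k = k ∧ Tendsto (fun N => cesaroMean P N *ᵥ v) atTop (𝓝 k) := by
  obtain ⟨k, u, hk, rfl⟩ := hP.exists_fixed_add_range v
  refine ⟨k, hk, ?_⟩
  simp only [mulVec_add]
  have h : Tendsto (fun N => cesaroMean P N *ᵥ k) atTop (𝓝 k) :=
    tendsto_const_nhds.congr' <| by
      filter_upwards [eventually_ne_atTop 0] with N hN
      exact (cesaroMean_mulVec_of_fixed hk hN).symm
  simpa using h.add (hP.tendsto_cesaroMean_mulVec_range u)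

theorem tendsto_cesaroMean (hP : IsStochastic P) :
    Tendsto (cesaroMean P) atTop (𝓝 (limitMatrix P)) := by
  choose k _ hk using fun y => hP.exists_tendsto_cesaroMean_mulVec (Pi.single y 1)
  refine tendsto_nhds_limUnder ⟨of fun x y => k y x, ?_⟩
  refine tendsto_pi_nhds.2 fun x => tendsto_pi_nhds.2 fun y => ?_
  simpa using tendsto_pi_nhds.1 (hk y) x

theorem tendsto_cesaroMean_mulVec (hP : IsStochastic P) (v : S → ℝ) :
    Tendsto (fun N => cesaroMean P N *ᵥ v) atTop (𝓝 (limitMatrix P *ᵥ v)) :=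
  ((continuous_id.matrix_mulVec continuous_const).tendsto _).comp hP.tendsto_cesaroMean

theorem mulVec_limitMatrix_mulVec (hP : IsStochastic P) (v : S → ℝ) :
    P *ᵥ (limitMatrix P *ᵥ v) = limitMatrix P *ᵥ v := by
  obtain ⟨k, hk, h⟩ := hP.exists_tendsto_cesaroMean_mulVec v
  rwa [tendsto_nhds_unique (hP.tendsto_cesaroMean_mulVec v) h]

theorem limitMatrix_mulVec_of_fixed (hP : IsStochastic P) {v : S → ℝ} (hv : P *ᵥ v = v) :
    limitMatrix P *ᵥ v = v := by
  refine tendsto_nhds_unique (hP.tendsto_cesaroMean_mulVec v) (tendsto_const_nhds.congr' ?_)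
  filter_upwards [eventually_ne_atTop 0] with N hN
  exact (cesaroMean_mulVec_of_fixed hv hN).symm

theorem limitMatrix_mulVec_range (hP : IsStochastic P) (u : S → ℝ) :
    limitMatrix P *ᵥ ((1 - P) *ᵥ u) = 0 :=
  tendsto_nhds_unique (hP.tendsto_cesaroMean_mulVec _) (hP.tendsto_cesaroMean_mulVec_range u)

theorem limitMatrix_mulVec_limitMatrix_mulVec (hP : IsStochastic P) (v : S → ℝ) :
    limitMatrix P *ᵥ (limitMatrix P *ᵥ v) = limitMatrix P *ᵥ v :=
  hP.limitMatrix_mulVec_of_fixed (hP.mulVec_limitMatrix_mulVec v)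

theorem limitMatrix_stochastic (hP : IsStochastic P) : IsStochastic (limitMatrix P) := by
  refine ⟨fun x y => ?_, hP.limitMatrix_mulVec_of_fixed hP.mulVec_one⟩
  refine ge_of_tendsto' (tendsto_pi_nhds.1 (tendsto_pi_nhds.1 hP.tendsto_cesaroMean x) y)
    fun N => ?_
  rw [cesaroMean, Matrix.smul_apply, Matrix.sum_apply]
  exact mul_nonneg (by positivity) (Finset.sum_nonneg fun n _ => (hP.pow n).nonneg x y)

/-! ### The fundamental and deviation matrices -/

theorem isUnit_fundamental (hP : IsStochastic P) : IsUnit (1 - P + limitMatrix P) := by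
  rw [← mulVec_injective_iff_isUnit]
  refine (injective_iff_map_eq_zero (1 - P + limitMatrix P).mulVecLin).2 fun v hv => ?_
  rw [mulVecLin_apply, add_mulVec] at hv
  -- The limit matrix is idempotent and kills the range of `1 - P`, so applying it to `hv` leaves
  -- only this term.
  have hQ : limitMatrix P *ᵥ v = 0 := by
    have h := congrArg (limitMatrix P *ᵥ ·) hv
    simpa [mulVec_add, -mulVec_mulVec, hP.limitMatrix_mulVec_range,
      hP.limitMatrix_mulVec_limitMatrix_mulVec] using h
  rw [hQ, add_zero, sub_mulVec, one_mulVec, sub_eq_zero] at hv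
  rw [← hP.limitMatrix_mulVec_of_fixed hv.symm, hQ]

theorem kemenyDefined (hP : IsStochastic P) : KemenyDefined P :=
  ⟨hP.tendsto_cesaroMean, hP.isUnit_fundamental⟩

theorem fundamental_mulVec_deviationMatrix_mulVec (hP : IsStochastic P) (v : S → ℝ) :
    (1 - P + limitMatrix P) *ᵥ (deviationMatrix P *ᵥ v) = v - limitMatrix P *ᵥ v := by
  rw [deviationMatrix, mulVec_mulVec, ← Matrix.mul_assoc,
    mul_nonsing_inv _ ((isUnit_iff_isUnit_det _).1 hP.isUnit_fundamental), Matrix.one_mul,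
    sub_mulVec, one_mulVec]

theorem limitMatrix_mulVec_deviationMatrix_mulVec (hP : IsStochastic P) (v : S → ℝ) :
    limitMatrix P *ᵥ (deviationMatrix P *ᵥ v) = 0 := by
  have h := congrArg (limitMatrix P *ᵥ ·) (hP.fundamental_mulVec_deviationMatrix_mulVec v)
  simpa [add_mulVec, mulVec_add, mulVec_sub, -mulVec_mulVec, hP.limitMatrix_mulVec_range,
    hP.limitMatrix_mulVec_limitMatrix_mulVec] using h

/-- The Poisson equation. -/
theorem one_sub_mulVec_deviationMatrix_mulVec (hP : IsStochastic P) (v : S → ℝ) :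
    (1 - P) *ᵥ (deviationMatrix P *ᵥ v) = v - limitMatrix P *ᵥ v := by
  rw [← hP.fundamental_mulVec_deviationMatrix_mulVec v, add_mulVec,
    hP.limitMatrix_mulVec_deviationMatrix_mulVec, add_zero]

theorem deviationMatrix_mulVec_one (hP : IsStochastic P) : deviationMatrix P *ᵥ 1 = 0 := by
  rw [deviationMatrix, ← mulVec_mulVec, sub_mulVec, one_mulVec, hP.limitMatrix_stochastic.mulVec_one,
    sub_self, mulVec_zero]

/-- The averaged partial sums of `P ^ t (v - P_∞ v)` converge to the deviation matrix applied
to `v`. -/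
theorem tendsto_avg_geom_sum (hP : IsStochastic P) (v : S → ℝ) :
    Tendsto (fun N : ℕ => (N : ℝ)⁻¹ • ∑ T ∈ Finset.Icc 1 N,
      (∑ t ∈ Finset.range T, P ^ t) *ᵥ (v - limitMatrix P *ᵥ v)) atTop
      (𝓝 (deviationMatrix P *ᵥ v)) := by
  set h := deviationMatrix P *ᵥ v with hh
  have hlim : Tendsto (fun N => h - P *ᵥ (cesaroMean P N *ᵥ h)) atTop (𝓝 h) := by
    have h1 := hP.tendsto_cesaroMean_mulVec h
    rw [hP.limitMatrix_mulVec_deviationMatrix_mulVec] at h1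
    have h2 := ((continuous_const.matrix_mulVec continuous_id).tendsto (0 : S → ℝ)).comp h1
      (f := fun N => cesaroMean P N *ᵥ h) (g := fun w => P *ᵥ w)
    simpa [-mulVec_mulVec, Function.comp_def] using (tendsto_const_nhds (x := h)).sub h2
  refine hlim.congr' ?_
  filter_upwards [eventually_ne_atTop 0] with N hN
  rw [← hP.one_sub_mulVec_deviationMatrix_mulVec v, ← hh]
  simp only [geom_sum_mulVec]
  -- Since `T` starts at 1, the averaged powers are `P` times a Cesàro mean; this is the error term
  -- in `hlim`.
  have hshift : ∑ T ∈ Finset.Icc 1 N, P ^ T = P * ∑ n ∈ Finset.range N, P ^ n := by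
    rw [Finset.mul_sum, Finset.range_eq_Ico]
    simp only [← pow_succ']
    rw [Finset.sum_Ico_add' (fun T => P ^ T) 0 N 1]
    rfl
  rw [Finset.sum_sub_distrib, ← sum_mulVec (Finset.Icc 1 N) (fun T => P ^ T) h, hshift, cesaroMean, smul_mulVec, mulVec_smul,
    mulVec_mulVec, smul_sub]
  congr 1
  ext x
  simp [hN]

/-- The maximum principle: a column of the deviation matrix is largest on the diagonal. -/
theorem deviationMatrix_le_diag (hP : IsStochastic P) (x z : S) :
    deviationMatrix P x z ≤ deviationMatrix P z z := by
  have hQ := hP.limitMatrix_stochastic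
  set Q := limitMatrix P with hQdef
  set f : S → ℝ := deviationMatrix P *ᵥ Pi.single z 1 with hf
  have hfx : ∀ y, deviationMatrix P y z = f y := fun y => by simp [hf]
  rw [hfx, hfx]
  by_contra! hlt
  obtain ⟨a, -, ha⟩ := Finset.exists_max_image Finset.univ f ⟨x, Finset.mem_univ x⟩
  replace ha : ∀ y, f y ≤ f a := fun y => ha y (Finset.mem_univ y)
  have hza : f z < f a := hlt.trans_le (ha x)
  -- By the Poisson equation, column `z` of the deviation matrix is subharmonic away from `z`.
  have hsub : ∀ y, y ≠ z → f y ≤ (P *ᵥ f) y := fun y hy => by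
    have h := congrFun (hP.one_sub_mulVec_deviationMatrix_mulVec (Pi.single z 1)) y
    rw [← hf, sub_mulVec, one_mulVec] at h
    simp [hy] at h
    linarith [hQ.nonneg y z]
  -- The set where `f` is maximal avoids `z`, so subharmonicity makes it closed under `P`.
  have hclosed : ∀ y, f y = f a → ∀ w, P y w ≠ 0 → f w = f a := by
    intro y hy w hw
    have hyz : y ≠ z := by rintro rfl; exact hza.ne hy
    have hs : ∑ w, P y w * (f a - f w) ≤ 0 := by
      have := hsub y hyz
      simp only [mul_sub, Finset.sum_sub_distrib, ← Finset.sum_mul, hP.row_sum, one_mul]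
      simp only [mulVec, dotProduct] at this
      linarith
    have hnn : ∀ w ∈ Finset.univ, 0 ≤ P y w * (f a - f w) := fun w _ =>
      mul_nonneg (hP.nonneg y w) (sub_nonneg.2 (ha w))
    have := (Finset.sum_eq_zero_iff_of_nonneg hnn).1
      (le_antisymm hs (Finset.sum_nonneg hnn)) w (Finset.mem_univ w)
    linarith [(mul_eq_zero.1 this).resolve_left hw]
  have hpow : ∀ n y, f y = f a → (P ^ n *ᵥ f) y = f a := by
    intro n
    induction n with
    | zero => intro y hy; simpa using hy
    | succ n ih =>
      intro y hy
      rw [pow_succ', ← mulVec_mulVec, mulVec, dotProduct]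
      calc ∑ w, P y w * (P ^ n *ᵥ f) w = ∑ w, P y w * f a := by
            refine Finset.sum_congr rfl fun w _ => ?_
            rcases eq_or_ne (P y w) 0 with h | h
            · rw [h, zero_mul, zero_mul]
            · rw [ih w (hclosed y hy w h)]
        _ = f a := by rw [← Finset.sum_mul, hP.row_sum, one_mul]
  have hQf : Q *ᵥ f = 0 := hP.limitMatrix_mulVec_deviationMatrix_mulVec _
  -- The chain never leaves the maximal set, so `(Q *ᵥ f) a = f a`, while `Q *ᵥ f = 0`.
  have hfa : f a = 0 := by
    refine tendsto_nhds_unique (tendsto_const_nhds.congr' ?_)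
      (tendsto_pi_nhds.1 (hQf ▸ hP.tendsto_cesaroMean_mulVec f) a)
    filter_upwards [eventually_ne_atTop 0] with N hN
    rw [cesaroMean, smul_mulVec, sum_mulVec, Pi.smul_apply, Finset.sum_apply,
      Finset.sum_congr rfl fun n _ => hpow n a rfl]
    simp [hN]
  -- Now `f ≤ 0`, so every term of `(Q *ᵥ f) z = 0` vanishes, whereas `f z < 0`.
  have hQz : Q z z = 0 := by
    have hnp : ∀ w ∈ Finset.univ, Q z w * f w ≤ 0 := fun w _ =>
      mul_nonpos_of_nonneg_of_nonpos (hQ.nonneg z w) (hfa ▸ ha w)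
    have := (Finset.sum_eq_zero_iff_of_nonpos hnp).1 (congrFun hQf z) z (Finset.mem_univ z)
    exact (mul_eq_zero.1 this).resolve_right (by linarith)
  -- With `Q z z = 0`, `f z` is a limit of averages of sums of return probabilities, contradicting
  -- `f z < 0`.
  have hfz : 0 ≤ f z := by
    refine ge_of_tendsto' (tendsto_pi_nhds.1 (hP.tendsto_avg_geom_sum (Pi.single z 1)) z)
      fun N => ?_
    rw [Pi.smul_apply, Finset.sum_apply]
    refine mul_nonneg (by positivity) (Finset.sum_nonneg fun T _ => ?_)
    rw [sum_mulVec, Finset.sum_apply]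
    refine Finset.sum_nonneg fun t _ => ?_
    rw [mulVec_sub, pow_mulVec_of_fixed (hP.mulVec_limitMatrix_mulVec _), ← hQdef]
    simpa [hQz] using (hP.pow t).nonneg z z
  linarith

/-! ### The span bound -/

/-- Each diagonal entry dominates the entry of row `x` in its column, and that row sums to zero. -/
theorem kemeny_nonneg [Nonempty S] (hP : IsStochastic P) : 0 ≤ kemeny P := by
  obtain ⟨x⟩ := ‹Nonempty S›
  have h : ∑ z, deviationMatrix P x z = 0 := by
    simpa [mulVec, dotProduct] using congrFun hP.deviationMatrix_mulVec_one x
  rw [← h]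
  exact Finset.sum_le_sum fun z _ => hP.deviationMatrix_le_diag x z

theorem deviationMatrix_mulVec_sub_le (hP : IsStochastic P) {v : S → ℝ} {m c : ℝ}
    (hm : ∀ z, m ≤ v z) (hc : ∀ z, v z ≤ m + c) (x y : S) :
    (deviationMatrix P *ᵥ v) x - (deviationMatrix P *ᵥ v) y ≤ c * kemeny P := by
  have hrow : ∀ x, ∑ z, deviationMatrix P x z = 0 := fun x => by
    simpa [mulVec, dotProduct] using congrFun hP.deviationMatrix_mulVec_one x
  have hle := fun x z => hP.deviationMatrix_le_diag x z
  set H := deviationMatrix P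
  -- Adding `(H z z - H x z) * (v z - m) ≥ 0` and `(H z z - H y z) * (m + c - v z) ≥ 0` gives a
  -- bound whose off-diagonal terms have coefficients free of `z`, so the zero row sums cancel them.
  have hterm : ∀ z, H x z * v z - H y z * v z ≤
      c * H z z - (c + m) * H y z + m * H x z := fun z => by
    nlinarith [mul_nonneg (sub_nonneg.2 (hle x z)) (sub_nonneg.2 (hm z)),
      mul_nonneg (sub_nonneg.2 (hle y z)) (sub_nonneg.2 (hc z))]
  calc (H *ᵥ v) x - (H *ᵥ v) y = ∑ z, (H x z * v z - H y z * v z) := by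
        rw [Finset.sum_sub_distrib]; rfl
    _ ≤ ∑ z, (c * H z z - (c + m) * H y z + m * H x z) := Finset.sum_le_sum fun z _ => hterm z
    _ = c * kemeny P := by
        rw [Finset.sum_add_distrib, Finset.sum_sub_distrib, ← Finset.mul_sum, ← Finset.mul_sum,
          ← Finset.mul_sum, hrow, hrow]
        simp [kemeny, trace, H]

theorem vecSpan_deviationMatrix_mulVec_le [Nonempty S] (hP : IsStochastic P) (v : S → ℝ) :
    vecSpan (deviationMatrix P *ᵥ v) ≤ vecSpan v * kemeny P := by
  have hle := hP.deviationMatrix_mulVec_sub_le (v := v) (m := ⨅ s, v s) (c := vecSpan v)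
    (fun z => ciInf_le (Set.finite_range v).bddBelow z)
    (fun z => by
      have := le_ciSup (Set.finite_range v).bddAbove z
      simpa [vecSpan] using this)
  rw [vecSpan, sub_le_iff_le_add]
  refine ciSup_le fun x => ?_
  rw [← sub_le_iff_le_add']
  exact le_ciInf fun y => by linarith [hle x y]

end IsStochastic

end FinChain

/-! ### Gain and bias of a policy through its induced chain -/

theorem vecSpan_nonneg {S : Type*} [Fintype S] [Nonempty S] (v : S → ℝ) : 0 ≤ vecSpan v :=
  sub_nonneg.2 (ciInf_le_ciSup (Set.finite_range v).bddBelow (Set.finite_range v).bddAbove)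

namespace FiniteMDP

open Matrix

variable {S A : Type*} [Fintype S] [DecidableEq S] [Fintype A]
  (M : FiniteMDP S A) (π : MemorylessPolicy S A)

theorem isStochastic_chain : FinChain.IsStochastic (M.chain π) := by
  refine ⟨fun x y => ?_, funext fun x => ?_⟩
  · exact Finset.sum_nonneg fun a _ => mul_nonneg (π.prob_nonneg x a) (M.trans_nonneg x a y)
  · simp only [mulVec, dotProduct, chain, of_apply, Pi.one_apply, mul_one]
    rw [Finset.sum_comm]
    simp [← Finset.mul_sum, M.trans_sum, π.prob_sum]

theorem stateLaw_eq_pow (s : S) (t : ℕ) (x : S) : M.stateLaw π s t x = (M.chain π ^ t) s x := by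
  induction t generalizing x with
  | zero => simp [stateLaw, one_apply, Pi.single_apply, eq_comm]
  | succ t ih =>
    rw [pow_succ, mul_apply, stateLaw]
    exact Finset.sum_congr rfl fun y _ => by rw [ih]; rfl

theorem expect_eq_pow_mulVec (s : S) (t : ℕ) (f : S → ℝ) :
    M.expect π s t f = (M.chain π ^ t *ᵥ f) s :=
  Finset.sum_congr rfl fun x _ => by rw [stateLaw_eq_pow]

theorem avgReward_eq_cesaroMean_mulVec (s : S) (T : ℕ) :
    M.avgReward π s T = (FinChain.cesaroMean (M.chain π) T *ᵥ M.rewardVec π) s := by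
  simp [avgReward, FinChain.cesaroMean, smul_mulVec, sum_mulVec, expect_eq_pow_mulVec]

theorem tendsto_avgReward (s : S) : Tendsto (M.avgReward π s) atTop
    (𝓝 ((FinChain.limitMatrix (M.chain π) *ᵥ M.rewardVec π) s)) :=
  (tendsto_pi_nhds.1 ((M.isStochastic_chain π).tendsto_cesaroMean_mulVec (M.rewardVec π)) s).congr
    fun T => (M.avgReward_eq_cesaroMean_mulVec π s T).symm

theorem gain_eq : M.gain π = FinChain.limitMatrix (M.chain π) *ᵥ M.rewardVec π :=
  funext fun s => (M.tendsto_avgReward π s).limUnder_eq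

theorem avgExcess_eq (s : S) (N : ℕ) :
    M.avgExcess π s N = ((N : ℝ)⁻¹ • ∑ T ∈ Finset.Icc 1 N,
      (∑ t ∈ Finset.range T, M.chain π ^ t) *ᵥ (M.rewardVec π -
        FinChain.limitMatrix (M.chain π) *ᵥ M.rewardVec π)) s := by
  simp only [avgExcess, excess, expect_eq_pow_mulVec, Pi.smul_apply, Finset.sum_apply, sum_mulVec,
    smul_eq_mul, ← gain_eq]
  rfl

theorem tendsto_avgExcess (s : S) : Tendsto (M.avgExcess π s) atTop
    (𝓝 ((FinChain.deviationMatrix (M.chain π) *ᵥ M.rewardVec π) s)) :=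
  (tendsto_pi_nhds.1 ((M.isStochastic_chain π).tendsto_avg_geom_sum (M.rewardVec π)) s).congr
    fun N => (M.avgExcess_eq π s N).symm

theorem bias_eq : M.bias π = FinChain.deviationMatrix (M.chain π) *ᵥ M.rewardVec π :=
  funext fun s => (M.tendsto_avgExcess π s).limUnder_eq

theorem gainBiasDefined : M.GainBiasDefined π :=
  ⟨fun s => tendsto_nhds_limUnder ⟨_, M.tendsto_avgReward π s⟩,
    fun s => tendsto_nhds_limUnder ⟨_, M.tendsto_avgExcess π s⟩⟩

theorem vecSpan_bias_le [Nonempty S] :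
    vecSpan (M.bias π) ≤ vecSpan (M.rewardVec π) * FinChain.kemeny (M.chain π) := by
  rw [bias_eq]
  exact (M.isStochastic_chain π).vecSpan_deviationMatrix_mulVec_le _

end FiniteMDP

theorem proposition5p4 {S A : Type*} [Fintype S] [DecidableEq S] [Nonempty S]
    [Fintype A] [Nonempty A] (M : FiniteMDP S A) :
    (M.IsErgodic ∨ M.IsUnichain →
      ∀ π : MemorylessPolicy S A,
        M.GainBiasDefined π ∧ FinChain.KemenyDefined (M.chain π) ∧
          vecSpan (M.bias π) ≤ 2 * vecSpan (M.rewardVec π) * FinChain.kemeny (M.chain π)) ∧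
    (M.IsWeaklyCommunicating →
      ∀ π : MemorylessPolicy S A, M.IsOptimal π →
        M.GainBiasDefined π ∧ FinChain.KemenyDefined (M.chain π) ∧
          vecSpan (M.bias π) ≤ 2 * vecSpan (M.rewardVec π) * FinChain.kemeny (M.chain π)) := by
  have h : ∀ π : MemorylessPolicy S A,
      M.GainBiasDefined π ∧ FinChain.KemenyDefined (M.chain π) ∧
        vecSpan (M.bias π) ≤ 2 * vecSpan (M.rewardVec π) * FinChain.kemeny (M.chain π) := fun π =>
    ⟨M.gainBiasDefined π, (M.isStochastic_chain π).kemenyDefined, by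
      -- The bound holds without the factor 2, which may be inserted because the right-hand side is
      -- nonnegative.
      nlinarith [M.vecSpan_bias_le π,
        mul_nonneg (vecSpan_nonneg (M.rewardVec π)) (M.isStochastic_chain π).kemeny_nonneg]⟩
  exact ⟨fun _ π => h π, fun _ π _ => h π⟩
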